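/- Let $n\ge 1$ be an integer, let $F(\theta)=\sqrt{\frac{1-\cos^{2n}\theta}{1-\cos^2\theta}}$, extended continuously by $F(k\pi)=\sqrt n$ for $k\in\mathbb Z$, and consider the autonomous system for $(\theta,T,Q)$ (flat universe, $\Lambda\neq0$, detailed balance, power-law potential $V(\phi)=\frac{1}{2n}(\mu\phi)^{2n}$ in Hořava–Lifshitz cosmology) \begin{align*} \theta' &= \frac{3Q(T-1)F(\theta)^2\sin(2\theta)}{2n}-T\,F(\theta),\\ T' &= \frac{3Q(T-1)^2\,T\,(1-\cos^{2n}\theta)}{n},\\ Q' &= -3(Q^2-1)(T-1)(1-\cos^{2n}\theta), \end{align*} on the phase space $\{\theta\in\mathbb R,\ 0\le T\le 1,\ -1\le Q\le 1\}$. A (possibly nonhyperbolic, non-isolated) equilibrium is called a saddle if it is Lyapunov stable neither to the future nor to the past and some nonconstant solution is asymptotic to it as time tends to $+\infty$ or to $-\infty$; only solutions in the phase space are considered. (i) The de Sitter point $dS^+$: $(\theta,T,Q)=(0,0,1)$ is unstable, namely a saddle; moreover some nonconstant solution converges to it as time tends to $+\infty$ and some nonconstant solution converges to it as time tends to $-\infty$.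 (ii) Each point $(\theta,T,Q)=(0,0,Q^*)$, $Q^*\neq 0,\pm1$, of the line $dS_+(Q^*)$ of equilibria is unstable, namely a saddle: it is an equilibrium that is unstable to the future and to the past, and some nonconstant solution converges to it as time tends to $+\infty$ if $Q^*>0$, and as time tends to $-\infty$ if $Q^*<0$. This holds in the phase space above if $|Q^*|<1$, and for all real $Q^*\ne 0,\pm1$ if $Q$ is not restricted to $[-1,1]$. -/

import Mathlib

open Set Filter Topology

noncomputable section

/-! ## Stability notions for autonomous vector fields

In what follows `f` is a vector field on a normed space `E`, `S` is the phase space (only solutions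
that stay in `S` are considered) and `p` is a point of `S`. Reversing time amounts to replacing
`f` by `-f`. -/

/-- `p` is Lyapunov stable to the future in the phase space `S`: solutions in `S` that start near
`p` remain near `p` for as long as they exist. -/
def LyapunovStable {E : Type*} [NormedAddCommGroup E] [NormedSpace ℝ E]
    (f : E → E) (S : Set E) (p : E) : Prop :=
  ∀ ε > 0, ∃ δ > 0, ∀ (γ : ℝ → E) (b : ℝ), 0 ≤ b →
    IsIntegralCurveOn γ (fun _ => f) (Icc 0 b) → (∀ t ∈ Icc 0 b, γ t ∈ S) →
    dist (γ 0) p < δ → dist (γ b) p < ε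

/-- Some solution in `S` other than the equilibrium itself converges to `p` as time tends
to `+∞`. -/
def AttractsOrbit {E : Type*} [NormedAddCommGroup E] [NormedSpace ℝ E]
    (f : E → E) (S : Set E) (p : E) : Prop :=
  ∃ γ : ℝ → E, IsIntegralCurveOn γ (fun _ => f) (Ici 0) ∧ (∀ t ∈ Ici (0 : ℝ), γ t ∈ S) ∧
    γ 0 ≠ p ∧ Tendsto γ atTop (𝓝 p)

/-- Some solution in `S` other than the equilibrium itself converges to `p` as time tends
to `-∞`. -/
def RepelsOrbit {E : Type*} [NormedAddCommGroup E] [NormedSpace ℝ E]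
    (f : E → E) (S : Set E) (p : E) : Prop :=
  AttractsOrbit (-f) S p

/-- An equilibrium point, possibly nonhyperbolic and non-isolated, is an (unstable) saddle if it is
neither stable to the future nor stable to the past, and some nonconstant solution
is asymptotic to it (to the future or to the past). For hyperbolic equilibria in the interior of
the phase space this is the usual notion. -/
structure IsSaddle {E : Type*} [NormedAddCommGroup E] [NormedSpace ℝ E]
    (f : E → E) (S : Set E) (p : E) : Prop where
  mem : p ∈ S
  equilibrium : f p = 0
  unstable_future : ¬ LyapunovStable f S p
  unstable_past : ¬ LyapunovStable (-f) S p
  asymptotic : AttractsOrbit f S p ∨ RepelsOrbit f S p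

/-! ## The dynamical system -/

/-- `F(θ) = √((1 - cos^{2n} θ) / (1 - cos² θ))`, extended continuously by `√n` to the removable
singularities `θ ∈ π ℤ`. -/
def powerF (n : ℕ) (θ : ℝ) : ℝ :=
  open Classical in
  if Real.sin θ = 0 then √(n : ℝ)
  else √((1 - Real.cos θ ^ (2 * n)) / (1 - Real.cos θ ^ 2))

/-- The extended `F` is given by one formula, so it is smooth. -/
theorem powerF_eq (n : ℕ) (θ : ℝ) :
    powerF n θ = √(∑ k ∈ Finset.range n, Real.cos θ ^ (2 * k)) := by
  have h1 : Real.cos θ ^ 2 = 1 - Real.sin θ ^ 2 := by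
    linarith [Real.sin_sq_add_cos_sq θ]
  unfold powerF
  split_ifs with h
  · have h2 : Real.cos θ ^ 2 = 1 := by rw [h1, h]; norm_num
    simp [pow_mul, h2]
  · have h2 : Real.cos θ ^ 2 ≠ 1 := by
      rw [h1]
      intro h3
      exact h (pow_eq_zero_iff (two_ne_zero)|>.1 (by linarith))
    simp only [pow_mul]
    rw [geom_sum_eq h2, ← neg_div_neg_eq]
    congr 2 <;> ring

/-- The vector field in the variables `(θ, T, Q)` for the potential `V(φ) = (μ φ)^{2n} / (2n)`. -/
def plField (n : ℕ) (x : ℝ × ℝ × ℝ) : ℝ × ℝ × ℝ :=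
  let θ := x.1
  let T := x.2.1
  let Q := x.2.2
  (3 * Q * (T - 1) * powerF n θ ^ 2 * Real.sin (2 * θ) / (2 * n) - T * powerF n θ,
    3 * Q * (T - 1) ^ 2 * T * (1 - Real.cos θ ^ (2 * n)) / n,
    -3 * (Q ^ 2 - 1) * (T - 1) * (1 - Real.cos θ ^ (2 * n)))

/-- The phase space of the cosmological model: `0 ≤ T ≤ 1` and `-1 ≤ Q ≤ 1`. -/
def plPhaseSpace : Set (ℝ × ℝ × ℝ) :=
  {x | x.2.1 ∈ Icc 0 1 ∧ x.2.2 ∈ Icc (-1) 1}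

/-- The set `0 ≤ T ≤ 1`, with no bound on `Q`. -/
def plStrip : Set (ℝ × ℝ × ℝ) :=
  {x | x.2.1 ∈ Icc 0 1}

end

/-! The factor `F` equals the square root of a geometric sum, so it is smooth and, for `n ≥ 1`,
satisfies `1 ≤ F ≤ n`. Near `(0, 0, Q)` with `Q > 0` the linearisation is `θ' = -3Qθ - √n T`, `T' =
Q' = 0`, so instability is a nonlinear effect.

Instability to the future: `T` never decreases and grows at least like a constant times `T θ²`. An
orbit with `T ≥ τ > 0` cannot evade this growth by resting at `θ = 0`, because there `θ' ≤ -T`.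
Quantitatively, `θ - C T + (τ/2) t` is nonincreasing for a suitable `C`, so the time spent near the
point is bounded in terms of `τ` (`exists_time_bound`).

Instability to the past: in the invariant plane `T = 0` the quantity `(1 - q²) / cos^{2n} θ` is
conserved where `cos θ ≠ 0`. Its level curve through `(0, 0, Q)` is a graph over `θ`, on which `θ`
decays exponentially; this is an attracted orbit (`attractsOrbit_plField`). Reversing a solution
that converges to the point gives an escaping solution of `-f`. The symmetry `(θ, T, Q) ↦ (-θ, T,
-Q)` reverses time and carries these results to `Q < 0`.

At `Q = 1` a repelled orbit is also needed. In the invariant plane `Q = 1`, orbits starting ever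
closer to the point take ever longer to reach a fixed sphere; shifting time and passing to a limit
gives an orbit confined to the ball for all negative times. The time bound then forces `T → 0`
backwards, and the damping of `θ` forces `θ → 0`.

The field is frozen outside a box by a retraction, which makes it bounded and Lipschitz, so
solutions are global. -/

/-! ## Global solutions of Lipschitz autonomous systems -/

section GlobalFlow

variable {E : Type*} [NormedAddCommGroup E] [NormedSpace ℝ E]

/-- A bounded Lipschitz vector field has global integral curves. -/
theorem exists_isIntegralCurve_of_lipschitzWith [CompleteSpace E] {g : E → E} {K L : NNReal}
    (hg : LipschitzWith K g) (hL : ∀ x, ‖g x‖ ≤ L) (x : E) :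
    ∃ γ : ℝ → E, γ 0 = x ∧ IsIntegralCurve γ (fun _ => g) := by
  have key : ∀ N : ℕ, ∃ α : ℝ → E, α 0 = x ∧
      ∀ t ∈ Icc (-(N + 1 : ℝ)) (N + 1), HasDerivWithinAt α (g (α t))
        (Icc (-(N + 1 : ℝ)) (N + 1)) t := by
    intro N
    have h0 : (0 : ℝ) ∈ Icc (-(N + 1 : ℝ)) (N + 1) := by
      constructor <;> linarith [(Nat.cast_nonneg N : (0 : ℝ) ≤ N)]
    -- The radius `L (N + 1)` is the farthest that a curve of speed at most `L` can travel. Using `N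
    -- + 1` keeps `0` interior to the interval even when `N = 0`.
    have hP : IsPicardLindelof (fun _ => g) (⟨0, h0⟩ : Icc (-(N + 1 : ℝ)) (N + 1)) x
        (L * (N + 1)) 0 L K :=
      { lipschitzOnWith := fun _ _ => hg.lipschitzOnWith
        continuousOn := fun _ _ => continuousOn_const
        norm_le := fun _ _ y _ => hL y
        mul_max_le := by simp }
    exact hP.exists_eq_forall_mem_Icc_hasDerivWithinAt₀
  choose α hα0 hα using key
  have hder : ∀ N : ℕ, ∀ t ∈ Ioo (-(N + 1 : ℝ)) (N + 1), HasDerivAt (α N) (g (α N t)) t :=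
    fun N t ht => (hα N t (Ioo_subset_Icc_self ht)).hasDerivAt (Icc_mem_nhds ht.1 ht.2)
  have heq : ∀ N M : ℕ, N ≤ M → ∀ t ∈ Ioo (-(N + 1 : ℝ)) (N + 1), α N t = α M t := by
    intro N M hNM
    have hc : (N : ℝ) ≤ M := by exact_mod_cast hNM
    have hN0 : (0 : ℝ) ≤ N := Nat.cast_nonneg N
    exact ODE_solution_unique_of_mem_Ioo (v := fun _ => g) (s := fun _ => univ) (K := K)
      (t₀ := 0) (fun _ _ => hg.lipschitzOnWith) (by constructor <;> linarith)
      (fun t ht => ⟨hder N t ht, mem_univ _⟩)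
      (fun t ht => ⟨hder M t ⟨by linarith [ht.1], by linarith [ht.2]⟩, mem_univ _⟩)
      (by rw [hα0, hα0])
  have hmem : ∀ t : ℝ, t ∈ Ioo (-((⌈|t|⌉₊ : ℝ) + 1)) ((⌈|t|⌉₊ : ℝ) + 1) := fun t => by
    have := Nat.le_ceil |t|
    rw [mem_Ioo, ← abs_lt]
    linarith
  -- The local solutions agree on overlaps, so near `t` the glued curve coincides with the single
  -- solution of index `⌈|t|⌉₊ + 1`.
  refine ⟨fun t => α ⌈|t|⌉₊ t, by simp [hα0], fun t => ?_⟩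
  have hev : ∀ᶠ s in 𝓝 t, |s| < |t| + 1 :=
    continuous_abs.continuousAt.eventually_lt_const (by linarith)
  have h1 : (fun s => α ⌈|s|⌉₊ s) =ᶠ[𝓝 t] α (⌈|t|⌉₊ + 1) := by
    filter_upwards [hev] with s hs
    refine heq _ _ ?_ s (hmem s)
    rw [Nat.ceil_le]
    push_cast
    linarith [Nat.le_ceil |t|]
  have h2 : t ∈ Ioo (-(((⌈|t|⌉₊ + 1 : ℕ) : ℝ) + 1)) (((⌈|t|⌉₊ + 1 : ℕ) : ℝ) + 1) := by
    have := hmem t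
    push_cast
    exact ⟨by linarith [this.1], by linarith [this.2]⟩
  have h3 := (hder _ t h2).congr_of_eventuallyEq h1
  rwa [← h1.eq_of_nhds] at h3

/-- Continuous dependence of integral curves on the initial point. -/
theorem IsIntegralCurve.dist_le_exp {g : E → E} {K : NNReal} (hg : LipschitzWith K g)
    {γ₁ γ₂ : ℝ → E} (h₁ : IsIntegralCurve γ₁ (fun _ => g)) (h₂ : IsIntegralCurve γ₂ (fun _ => g))
    (t : ℝ) : dist (γ₁ t) (γ₂ t) ≤ dist (γ₁ 0) (γ₂ 0) * Real.exp (K * |t|) := by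
  rcases le_total 0 t with ht | ht
  · have := dist_le_of_trajectories_ODE (v := fun _ => g) (a := 0) (b := t) (fun _ => hg)
      h₁.continuous.continuousOn (fun s _ => (h₁ s).hasDerivWithinAt)
      h₂.continuous.continuousOn (fun s _ => (h₂ s).hasDerivWithinAt) le_rfl t ⟨ht, le_rfl⟩
    simpa [abs_of_nonneg ht] using this
  · have hneg : LipschitzWith K (-g) := hg.neg
    have hr : ∀ {γ : ℝ → E}, IsIntegralCurve γ (fun _ => g) →
        IsIntegralCurve (fun s => γ (-s)) (fun _ => -g) := fun {γ} h s => by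
      simpa [Function.comp_def] using (h (-s)).scomp s (hasDerivAt_neg s)
    have := dist_le_of_trajectories_ODE (v := fun _ => -g) (a := 0) (b := -t) (fun _ => hneg)
      (hr h₁).continuous.continuousOn (fun s _ => (hr h₁ s).hasDerivWithinAt)
      (hr h₂).continuous.continuousOn (fun s _ => (hr h₂ s).hasDerivWithinAt) le_rfl (-t)
      ⟨by linarith, le_rfl⟩
    simpa [abs_of_nonpos ht] using this

/-- A continuous function that exceeds a level has a first time at which it takes that level. -/
theorem exists_first_hitting {d : ℝ → ℝ} (hd : Continuous d) {ε s : ℝ} (hs : 0 ≤ s)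
    (h0 : d 0 < ε) (hds : ε ≤ d s) : ∃ b, 0 ≤ b ∧ d b = ε ∧ ∀ t ∈ Icc 0 b, d t ≤ ε := by
  set A := {t ∈ Icc 0 s | ε ≤ d t}
  have hAc : IsCompact A := isCompact_Icc.inter_right (isClosed_le continuous_const hd)
  have hA : A.Nonempty := ⟨s, ⟨hs, le_rfl⟩, hds⟩
  obtain ⟨b, ⟨hbI, hb⟩, hmin⟩ := hAc.exists_isLeast hA
  have hlt : ∀ t ∈ Ico 0 b, d t < ε := fun t ht => by
    by_contra! h
    exact absurd (hmin ⟨⟨ht.1, ht.2.le.trans hbI.2⟩, h⟩) (not_le.2 ht.2)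
  have hb0 : 0 < b := by
    rcases hbI.1.eq_or_lt with h | h
    · rw [← h] at hb; linarith
    · exact h
  have hle : d b ≤ ε := by
    have hcl : b ∈ closure (Ico 0 b) := by
      rw [closure_Ico hb0.ne]; exact ⟨hb0.le, le_rfl⟩
    exact closure_minimal (fun t ht => (hlt t ht).le) (isClosed_le hd continuous_const) hcl
  refine ⟨b, hb0.le, hle.antisymm hb, fun t ht => ?_⟩
  rcases ht.2.eq_or_lt with h | h
  · rw [h]; exact hle
  · exact (hlt t ⟨ht.1, h⟩).le

/-- If forward orbits starting arbitrarily close to an equilibrium `p` leave a ball around `p`,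
then some orbit through the boundary of the ball stays in the ball for all negative times. The
orbit inherits every closed positive constraint `C`. -/
theorem exists_isIntegralCurve_mem_closedBall_of_exit [CompleteSpace E] [ProperSpace E]
    {g : E → E} {K L : NNReal} (hg : LipschitzWith K g) (hL : ∀ x, ‖g x‖ ≤ L) {p : E}
    (hp : g p = 0) {ε : ℝ} (hε : 0 < ε) {C : Set E} (hC : IsClosed C)
    (h : ∀ δ > 0, ∃ γ : ℝ → E, IsIntegralCurve γ (fun _ => g) ∧ dist (γ 0) p < δ ∧
      (∀ t, 0 ≤ t → γ t ∈ C) ∧ ∃ t, 0 ≤ t ∧ ε ≤ dist (γ t) p) :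
    ∃ γ : ℝ → E, IsIntegralCurve γ (fun _ => g) ∧ dist (γ 0) p = ε ∧
      ∀ t ≤ 0, γ t ∈ C ∧ dist (γ t) p ≤ ε := by
  have h1 : ∀ k : ℕ, ∃ γ : ℝ → E, ∃ b : ℝ, 0 ≤ b ∧ IsIntegralCurve γ (fun _ => g) ∧
      dist (γ 0) p < ε / (k + 1) ∧ (∀ t, 0 ≤ t → γ t ∈ C) ∧ dist (γ b) p = ε ∧
      ∀ t ∈ Icc 0 b, dist (γ t) p ≤ ε := by
    intro k
    have hk : (0 : ℝ) ≤ k := Nat.cast_nonneg k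
    have hpos : 0 < ε / (k + 1) := by positivity
    obtain ⟨γ, hγ, h0, hγC, s, hs, hsε⟩ := h _ hpos
    have hlt : dist (γ 0) p < ε := h0.trans_le (div_le_self hε.le (by linarith))
    obtain ⟨b, hb0, hb, hbε⟩ := exists_first_hitting (hγ.continuous.dist continuous_const) hs hlt hsε
    exact ⟨γ, b, hb0, hγ, h0, hγC, hb, hbε⟩
  choose γ b hb0 hγ h0 hγC hb hbε using h1
  have hconst : IsIntegralCurve (fun _ : ℝ => p) (fun _ => g) := fun t => by
    simpa [hp] using hasDerivAt_const t p
  -- The exit times tend to infinity: comparison with the constant solution `p` gives `ε ≤ ε / (k +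
  -- 1) * exp (K a)` if `b k < a`, which fails for large `k`.
  have hb' : ∀ a : ℝ, 0 ≤ a → ∀ᶠ k in atTop, a ≤ b k := by
    intro a ha
    have hev : ∀ᶠ k : ℕ in atTop, Real.exp (K * a) < k :=
      tendsto_natCast_atTop_atTop.eventually_gt_atTop _
    filter_upwards [hev] with k hk
    by_contra! hlt
    have hk0 : (0 : ℝ) ≤ k := Nat.cast_nonneg k
    have e1 := (hγ k).dist_le_exp hg hconst (b k)
    rw [hb k, abs_of_nonneg (hb0 k)] at e1
    have e2 : Real.exp (K * b k) ≤ Real.exp (K * a) := by gcongr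
    have e3 : dist (γ k 0) p * Real.exp (K * b k) ≤ ε / (k + 1) * Real.exp (K * a) := by
      gcongr
      exact (h0 k).le
    have e4 : ε / (k + 1) * Real.exp (K * a) < ε := by
      rw [div_mul_eq_mul_div, div_lt_iff₀ (by positivity)]
      nlinarith
    linarith
  have hcomp : IsCompact (Metric.sphere p ε) := isCompact_sphere p ε
  obtain ⟨x, hx, φ, hφ, hlim⟩ := hcomp.tendsto_subseq (x := fun k => γ k (b k)) hb
  obtain ⟨σ, hσ0, hσ⟩ := exists_isIntegralCurve_of_lipschitzWith hg hL x
  refine ⟨σ, hσ, by rw [hσ0]; exact hx, fun t ht => ?_⟩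
  -- The curves, shifted so that they exit at time `0`, converge pointwise to `σ` by continuous
  -- dependence on the exit point.
  have hconv : Tendsto (fun k => γ (φ k) (t + b (φ k))) atTop (𝓝 (σ t)) := by
    rw [tendsto_iff_dist_tendsto_zero]
    have hz : Tendsto (fun k => dist (γ (φ k) (b (φ k))) x * Real.exp (K * |t|)) atTop (𝓝 0) := by
      simpa using (tendsto_iff_dist_tendsto_zero.1 hlim).mul_const (Real.exp (K * |t|))
    refine squeeze_zero (fun _ => dist_nonneg) (fun k => ?_) hz
    have := ((hγ (φ k)).comp_add (b (φ k))).dist_le_exp hg hσ t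
    simpa [hσ0] using this
  have hev : ∀ᶠ k in atTop, γ (φ k) (t + b (φ k)) ∈ C ∩ Metric.closedBall p ε := by
    filter_upwards [hφ.tendsto_atTop.eventually (hb' (-t) (by linarith))] with k hk
    exact ⟨hγC _ _ (by linarith), hbε _ _ ⟨by linarith, by linarith⟩⟩
  exact (hC.inter Metric.isClosed_closedBall).mem_of_tendsto hconv hev

/-- A `C¹` vector field composed with a Lipschitz retraction to a compact convex set is bounded
and Lipschitz. -/
theorem ContDiff.exists_lipschitzWith_comp {g : E → E} (hg : ContDiff ℝ 1 g) {P : E → E}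
    {K₀ : NNReal} (hP : LipschitzWith K₀ P) {B : Set E} (hB : IsCompact B) (hBc : Convex ℝ B)
    (hPB : ∀ x, P x ∈ B) :
    ∃ K L : NNReal, LipschitzWith K (fun x => g (P x)) ∧ ∀ x, ‖g (P x)‖ ≤ L := by
  obtain ⟨K, hK⟩ := hg.contDiffOn.exists_lipschitzOnWith one_ne_zero hBc hB
  obtain ⟨L, hL⟩ := hB.exists_bound_of_continuousOn hg.continuous.continuousOn
  refine ⟨K * K₀, L.toNNReal, ?_, fun x => (hL _ (hPB x)).trans (Real.le_coe_toNNReal L)⟩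
  rw [← lipschitzOnWith_univ]
  exact hK.comp hP.lipschitzOnWith (fun x _ => hPB x)

end GlobalFlow

/-- Monotonicity from the sign of the derivative. -/
theorem antitoneOn_of_hasDerivAt_nonpos {s : Set ℝ} (hs : Convex ℝ s) {w w' : ℝ → ℝ}
    (hw : ∀ t, HasDerivAt w (w' t) t) (h : ∀ t ∈ s, w' t ≤ 0) : AntitoneOn w s :=
  antitoneOn_of_deriv_nonpos hs (fun t _ => (hw t).continuousAt.continuousWithinAt)
    (fun t _ => (hw t).differentiableAt.differentiableWithinAt)
    (fun t ht => by rw [(hw t).deriv]; exact h t (interior_subset ht))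

/-! ## Stability and symmetry -/

section Stability

variable {E : Type*} [NormedAddCommGroup E] [NormedSpace ℝ E] {f : E → E} {S : Set E} {p : E}

/-- An equilibrium that attracts an orbit is unstable to the past. -/
theorem AttractsOrbit.not_lyapunovStable_neg (h : AttractsOrbit f S p) :
    ¬ LyapunovStable (-f) S p := by
  obtain ⟨γ, hγ, hS, h0, hlim⟩ := h
  intro hst
  obtain ⟨δ, hδ, H⟩ := hst (dist (γ 0) p) (dist_pos.2 h0)
  obtain ⟨b, hb, hb0⟩ := (((Metric.tendsto_nhds.1 hlim) δ hδ).and (eventually_ge_atTop 0)).exists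
  -- The reversed orbit starts within `δ` of `p` and ends at `γ 0`, at distance exactly the chosen
  -- `ε`.
  have key := H (fun s => γ (b - s)) b hb0 ?_ (fun t ht => hS _ (sub_nonneg.2 ht.2)) (by simpa)
  · simp at key
  · intro t ht
    have h1 := hγ (b - t) (sub_nonneg.2 ht.2)
    have h2 : HasDerivWithinAt (fun s => b - s) (-1) (Icc 0 b) t := by
      simpa using ((hasDerivAt_id t).const_sub b).hasDerivWithinAt
    have := h1.scomp t h2 (fun s hs => sub_nonneg.2 hs.2)
    simpa [Function.comp_def] using this

/-- An equilibrium that repels an orbit is unstable to the future. -/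
theorem RepelsOrbit.not_lyapunovStable (h : RepelsOrbit f S p) : ¬ LyapunovStable f S p := by
  simpa using AttractsOrbit.not_lyapunovStable_neg h

/-- If solutions of a modified system that start near `p` leave a ball on which the modified
system agrees with `f`, then `p` is unstable. -/
theorem not_lyapunovStable_of_exit {g : E → E} {ε : ℝ} (hε : 0 < ε)
    (h : ∀ δ > 0, ∃ γ : ℝ → E, IsIntegralCurve γ (fun _ => g) ∧ dist (γ 0) p < δ ∧
      (∀ t, 0 ≤ t → dist (γ t) p ≤ ε → γ t ∈ S ∧ g (γ t) = f (γ t)) ∧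
      ∃ t, 0 ≤ t ∧ ε ≤ dist (γ t) p) :
    ¬ LyapunovStable f S p := by
  intro hst
  obtain ⟨δ, hδ, H⟩ := hst ε hε
  obtain ⟨γ, hγ, h0, hS, s, hs, hsε⟩ := h (min δ ε) (lt_min hδ hε)
  obtain ⟨b, hb0, hb, hbε⟩ := exists_first_hitting (hγ.continuous.dist continuous_const) hs
    (h0.trans_le (min_le_right _ _)) hsε
  have := H γ b hb0 (fun t ht => ?_) (fun t ht => (hS t ht.1 (hbε t ht)).1)
    (h0.trans_le (min_le_left _ _))
  · exact absurd this (not_lt.2 hb.ge)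
  · change HasDerivWithinAt γ (f (γ t)) _ t
    rw [← (hS t ht.1 (hbε t ht)).2]
    exact (hγ t).hasDerivWithinAt

/-- Attracted orbits are carried along by linear symmetries. -/
theorem AttractsOrbit.map {g : E → E} (R : E →L[ℝ] E) (hR : Function.Injective R)
    (hfg : ∀ x, g (R x) = R (f x)) (hS : ∀ x ∈ S, R x ∈ S) (h : AttractsOrbit f S p) :
    AttractsOrbit g S (R p) := by
  obtain ⟨γ, hγ, hγS, h0, hlim⟩ := h
  refine ⟨fun t => R (γ t), fun t ht => ?_, fun t ht => hS _ (hγS t ht), hR.ne h0,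
    (R.continuous.tendsto p).comp hlim⟩
  change HasDerivWithinAt _ (g (R (γ t))) _ t
  rw [hfg]
  exact R.hasFDerivAt.comp_hasDerivWithinAt t (hγ t ht)

/-- Stability is carried back by isometric linear symmetries. -/
theorem LyapunovStable.of_map {g : E → E} (R : E →L[ℝ] E) (hR : Isometry R)
    (hfg : ∀ x, g (R x) = R (f x)) (hS : ∀ x ∈ S, R x ∈ S) (h : LyapunovStable g S (R p)) :
    LyapunovStable f S p := by
  intro ε hε
  obtain ⟨δ, hδ, H⟩ := h ε hε
  refine ⟨δ, hδ, fun γ b hb hγ hγS h0 => ?_⟩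
  have := H (fun t => R (γ t)) b hb (fun t ht => ?_) (fun t ht => hS _ (hγS t ht))
    (by rwa [hR.dist_eq])
  · rwa [hR.dist_eq] at this
  · change HasDerivWithinAt _ (g (R (γ t))) _ t
    rw [hfg]
    exact R.hasFDerivAt.comp_hasDerivWithinAt t (hγ t ht)

end Stability

/-! ## Estimates for the power-law field -/

theorem powerF_sq (n : ℕ) (θ : ℝ) :
    powerF n θ ^ 2 = ∑ k ∈ Finset.range n, Real.cos θ ^ (2 * k) := by
  rw [powerF_eq, Real.sq_sqrt]
  exact Finset.sum_nonneg fun k _ => (even_two_mul k).pow_nonneg _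

theorem powerF_nonneg (n : ℕ) (θ : ℝ) : 0 ≤ powerF n θ := by
  rw [powerF_eq]; exact Real.sqrt_nonneg _

theorem one_le_sum_cos_pow {n : ℕ} (hn : 1 ≤ n) (θ : ℝ) :
    1 ≤ ∑ k ∈ Finset.range n, Real.cos θ ^ (2 * k) := by
  have := Finset.single_le_sum (f := fun k => Real.cos θ ^ (2 * k))
    (fun k _ => (even_two_mul k).pow_nonneg _) (Finset.mem_range.2 (by omega : 0 < n))
  simpa using this

theorem one_le_powerF {n : ℕ} (hn : 1 ≤ n) (θ : ℝ) : 1 ≤ powerF n θ := by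
  rw [powerF_eq, Real.one_le_sqrt]
  exact one_le_sum_cos_pow hn θ

theorem cos_pow_two_mul_le_one (k : ℕ) (θ : ℝ) : Real.cos θ ^ (2 * k) ≤ 1 := by
  rw [pow_mul]
  exact pow_le_one₀ (sq_nonneg _) (Real.cos_sq_le_one θ)

theorem powerF_sq_le (n : ℕ) (θ : ℝ) : powerF n θ ^ 2 ≤ n := by
  rw [powerF_sq]
  calc _ ≤ ∑ k ∈ Finset.range n, (1 : ℝ) :=
        Finset.sum_le_sum fun k _ => cos_pow_two_mul_le_one k θ
    _ = n := by simp

theorem powerF_le (n : ℕ) (θ : ℝ) : powerF n θ ≤ n := by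
  rcases Nat.eq_zero_or_pos n with rfl | hn
  · simp [powerF_eq]
  · nlinarith [powerF_sq_le n θ, one_le_powerF hn θ]

/-- This is the geometric sum identity; it exposes the common factor `F² sin θ` of `θ'` and `Q'` on
`T = 0`. -/
theorem one_sub_cos_pow_eq (n : ℕ) (θ : ℝ) :
    1 - Real.cos θ ^ (2 * n) = powerF n θ ^ 2 * Real.sin θ ^ 2 := by
  have h := mul_neg_geom_sum (Real.cos θ ^ 2) n
  rw [powerF_sq, Real.sin_sq]
  simp only [pow_mul]
  linarith

theorem sin_sq_le_one_sub_cos_pow {n : ℕ} (hn : 1 ≤ n) (θ : ℝ) :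
    Real.sin θ ^ 2 ≤ 1 - Real.cos θ ^ (2 * n) := by
  rw [one_sub_cos_pow_eq]
  have h : 1 ≤ powerF n θ ^ 2 := one_le_pow₀ (one_le_powerF hn θ)
  nlinarith [sq_nonneg (Real.sin θ)]

/-- The sum under the root contains the term `1`, so the root stays away from its singularity at
`0`. -/
theorem contDiff_powerF {n : ℕ} (hn : 1 ≤ n) : ContDiff ℝ 1 (powerF n) := by
  have h : powerF n = fun θ => √(∑ k ∈ Finset.range n, Real.cos θ ^ (2 * k)) :=
    funext (powerF_eq n)
  rw [h]
  refine ContDiff.sqrt (by fun_prop) fun θ => ?_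
  linarith [one_le_sum_cos_pow hn θ]

theorem contDiff_plField {n : ℕ} (hn : 1 ≤ n) : ContDiff ℝ 1 (plField n) := by
  have h := contDiff_powerF hn
  unfold plField
  fun_prop

theorem plField_apply_de_sitter (n : ℕ) (Q : ℝ) : plField n (0, 0, Q) = 0 := by
  simp [plField]

theorem abs_le_two_mul_abs_sin {x : ℝ} (hx : |x| ≤ 1) : |x| ≤ 2 * |Real.sin x| := by
  have h := Real.mul_abs_le_abs_sin (x := x) (by linarith [Real.pi_gt_three])
  have h2 : 1 / 2 ≤ 2 / Real.pi := by
    rw [div_le_div_iff₀ (by norm_num) Real.pi_pos]; linarith [Real.pi_le_four]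
  nlinarith [abs_nonneg x]

theorem sq_le_four_mul_sin_sq {x : ℝ} (hx : |x| ≤ 1) : x ^ 2 ≤ 4 * Real.sin x ^ 2 := by
  have h := abs_le_two_mul_abs_sin hx
  rw [← sq_abs x, ← sq_abs (Real.sin x)]
  nlinarith [abs_nonneg x]

theorem mul_sin_nonneg {x : ℝ} (hx : |x| ≤ 1) : 0 ≤ x * Real.sin x := by
  have h := abs_le.1 hx
  rcases le_total 0 x with h0 | h0
  · exact mul_nonneg h0 (Real.sin_nonneg_of_nonneg_of_le_pi h0 (by linarith [Real.pi_gt_three]))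
  · exact mul_nonneg_of_nonpos_of_nonpos h0
      (Real.sin_nonpos_of_nonpos_of_neg_pi_le h0 (by linarith [Real.pi_gt_three]))

theorem sq_le_mul_sin_two_mul {x : ℝ} (hx : |x| ≤ 1 / 2) : x ^ 2 ≤ x * Real.sin (2 * x) := by
  have h2 : |2 * x| ≤ 1 := by rw [abs_mul, abs_two]; linarith
  have h1 := abs_le_two_mul_abs_sin h2
  have h3 := mul_sin_nonneg h2
  have h4 : x * Real.sin (2 * x) = |x| * |Real.sin (2 * x)| := by
    rw [← abs_mul, abs_of_nonneg]; linarith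
  rw [abs_mul, abs_two] at h1
  rw [h4, ← sq_abs]
  nlinarith [abs_nonneg x]

/-! ## The truncated field -/

/-- The retraction of `ℝ` to `[a, b]`. -/
def clamp (a b x : ℝ) : ℝ := max a (min b x)

theorem lipschitzWith_clamp (a b : ℝ) : LipschitzWith 1 (clamp a b) :=
  (LipschitzWith.id.const_min b).const_max a

theorem clamp_mem {a b : ℝ} (h : a ≤ b) (x : ℝ) : clamp a b x ∈ Icc a b :=
  ⟨le_max_left _ _, max_le h (min_le_left _ _)⟩

theorem clamp_of_mem {a b x : ℝ} (h : x ∈ Icc a b) : clamp a b x = x := by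
  simp [clamp, h.1, h.2]

theorem abs_clamp_le {a x : ℝ} (ha : 0 ≤ a) : |clamp (-a) a x| ≤ a :=
  abs_le.2 (clamp_mem (by linarith) x)

/-- The retraction of the state space to the box `[-1/2, 1/2] × [0, 1/2] × [lo, hi]`. -/
noncomputable def boxProj (lo hi : ℝ) (x : ℝ × ℝ × ℝ) : ℝ × ℝ × ℝ :=
  (clamp (-(1 / 2)) (1 / 2) x.1, clamp 0 (1 / 2) x.2.1, clamp lo hi x.2.2)

/-- The field that agrees with `plField n` on the box `[-1/2, 1/2] × [0, 1/2] × [lo, hi]` and is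
bounded and Lipschitz. -/
noncomputable def boxField (n : ℕ) (lo hi : ℝ) (x : ℝ × ℝ × ℝ) : ℝ × ℝ × ℝ :=
  plField n (boxProj lo hi x)

theorem boxField_eq {n : ℕ} {lo hi : ℝ} {x : ℝ × ℝ × ℝ} (h1 : |x.1| ≤ 1 / 2)
    (h2 : x.2.1 ∈ Icc 0 (1 / 2)) (h3 : x.2.2 ∈ Icc lo hi) : boxField n lo hi x = plField n x := by
  unfold boxField boxProj
  rw [clamp_of_mem (abs_le.1 h1), clamp_of_mem h2, clamp_of_mem h3]

theorem exists_lipschitzWith_boxField {n : ℕ} (hn : 1 ≤ n) {lo hi : ℝ} (h : lo ≤ hi) :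
    ∃ K L : NNReal, LipschitzWith K (boxField n lo hi) ∧ ∀ x, ‖boxField n lo hi x‖ ≤ L := by
  refine (contDiff_plField hn).exists_lipschitzWith_comp (P := boxProj lo hi) (K₀ := 1)
    (B := Icc (-(1 / 2)) (1 / 2) ×ˢ Icc 0 (1 / 2) ×ˢ Icc lo hi) ?_
    (isCompact_Icc.prod (isCompact_Icc.prod isCompact_Icc))
    ((convex_Icc _ _).prod ((convex_Icc _ _).prod (convex_Icc _ _)))
    fun x => ⟨clamp_mem (by norm_num) _, clamp_mem (by norm_num) _, clamp_mem h _⟩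
  have h1 := (lipschitzWith_clamp (-(1 / 2)) (1 / 2)).comp
    (LipschitzWith.prod_fst (α := ℝ) (β := ℝ × ℝ))
  have h2 := (lipschitzWith_clamp 0 (1 / 2)).comp (LipschitzWith.prod_fst.comp
    (LipschitzWith.prod_snd (α := ℝ) (β := ℝ × ℝ)))
  have h3 := (lipschitzWith_clamp lo hi).comp (LipschitzWith.prod_snd.comp
    (LipschitzWith.prod_snd (α := ℝ) (β := ℝ × ℝ)))
  have h := h1.prodMk (h2.prodMk h3)
  rwa [mul_one, mul_one, max_self, max_self] at h

/-! ### Drift of `θ` and `T`, and exit from small balls. -/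

section BoxField

variable {n : ℕ} {lo hi : ℝ} {γ : ℝ → ℝ × ℝ × ℝ}

theorem IsIntegralCurve.hasDerivAt_coords {f : ℝ × ℝ × ℝ → ℝ × ℝ × ℝ}
    (hγ : IsIntegralCurve γ (fun _ => f)) (t : ℝ) :
    HasDerivAt (fun t => (γ t).1) (f (γ t)).1 t ∧
      HasDerivAt (fun t => (γ t).2.1) (f (γ t)).2.1 t ∧
      HasDerivAt (fun t => (γ t).2.2) (f (γ t)).2.2 t :=
  ⟨(hγ t).fst, (hγ t).snd.fst, (hγ t).snd.snd⟩

theorem boxField_snd_fst_nonneg (hlo : 0 < lo) (hlh : lo ≤ hi) (x : ℝ × ℝ × ℝ) :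
    0 ≤ (boxField n lo hi x).2.1 := by
  have hT := (clamp_mem (by norm_num : (0 : ℝ) ≤ 1 / 2) x.2.1).1
  have hQ := (clamp_mem hlh x.2.2).1
  have hQ0 : 0 ≤ clamp lo hi x.2.2 := hlo.le.trans hQ
  have hc := cos_pow_two_mul_le_one n (clamp (-(1 / 2)) (1 / 2) x.1)
  have hc' := sub_nonneg.2 hc
  simp only [boxField, plField, boxProj]
  positivity

theorem monotone_snd_fst_of_isIntegralCurve (hlo : 0 < lo) (hlh : lo ≤ hi)
    (hγ : IsIntegralCurve γ (fun _ => boxField n lo hi)) : Monotone fun t => (γ t).2.1 :=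
  monotone_of_hasDerivAt_nonneg (fun t => (hγ.hasDerivAt_coords t).2.1)
    (fun t => boxField_snd_fst_nonneg hlo hlh (γ t))

/-- The bounds `F² ≤ n` and `|sin 2θ| ≤ 2|θ|` control the first term of `θ'`, and `F ≥ 1` makes the
second at most `-T`. -/
theorem boxField_fst_le (hn : 1 ≤ n) (hlo : 0 < lo) (hlh : lo ≤ hi) (x : ℝ × ℝ × ℝ) :
    (boxField n lo hi x).1 ≤
      3 * hi * |clamp (-(1 / 2)) (1 / 2) x.1| - clamp 0 (1 / 2) x.2.1 := by
  have hT := clamp_mem (by norm_num : (0 : ℝ) ≤ 1 / 2) x.2.1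
  have hQ := clamp_mem hlh x.2.2
  simp only [boxField, plField, boxProj]
  set θ := clamp (-(1 / 2)) (1 / 2) x.1
  set T := clamp 0 (1 / 2) x.2.1
  set Q := clamp lo hi x.2.2
  have hF1 := one_le_powerF hn θ
  have hF := powerF_sq_le n θ
  have hn0 : (0 : ℝ) < n := by exact_mod_cast hn
  have hQ0 : 0 < Q := hlo.trans_le hQ.1
  have hs : |Real.sin (2 * θ)| ≤ 2 * |θ| := by
    simpa [abs_mul] using Real.abs_sin_le_abs (x := 2 * θ)
  have e1 : 3 * Q * (T - 1) * powerF n θ ^ 2 * Real.sin (2 * θ) / (2 * n) ≤ 3 * hi * |θ| := by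
    rw [div_le_iff₀ (by positivity)]
    calc _ ≤ |3 * Q * (T - 1) * powerF n θ ^ 2 * Real.sin (2 * θ)| := le_abs_self _
      _ = 3 * Q * |T - 1| * powerF n θ ^ 2 * |Real.sin (2 * θ)| := by
        simp only [abs_mul, abs_pow, abs_of_pos hQ0, sq_abs]; norm_num
      _ ≤ 3 * hi * 1 * n * (2 * |θ|) := by
        have : |T - 1| ≤ 1 := abs_le.2 ⟨by linarith [hT.1], by linarith [hT.2]⟩
        have hhi : 0 ≤ hi := by linarith
        gcongr
        exact hQ.2
      _ = _ := by ring
  nlinarith [hT.1]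

/-- The constant collects `(T - 1)² ≥ 1/4` and `1 - cos^{2n} θ ≥ sin² θ ≥ θ²/4`, valid on the box.
-/
theorem le_boxField_snd_fst (hn : 1 ≤ n) (hlo : 0 < lo) (hlh : lo ≤ hi) (x : ℝ × ℝ × ℝ) :
    3 * lo / (16 * n) * (clamp 0 (1 / 2) x.2.1 * clamp (-(1 / 2)) (1 / 2) x.1 ^ 2) ≤
      (boxField n lo hi x).2.1 := by
  have hT := clamp_mem (by norm_num : (0 : ℝ) ≤ 1 / 2) x.2.1
  have hQ := clamp_mem hlh x.2.2
  have hθ := abs_clamp_le (x := x.1) (by norm_num : (0 : ℝ) ≤ 1 / 2)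
  simp only [boxField, plField, boxProj]
  set θ := clamp (-(1 / 2)) (1 / 2) x.1
  set T := clamp 0 (1 / 2) x.2.1
  set Q := clamp lo hi x.2.2
  have hn0 : (0 : ℝ) < n := by exact_mod_cast hn
  have hs := sq_le_four_mul_sin_sq (x := θ) (by linarith)
  have hc := sin_sq_le_one_sub_cos_pow hn θ
  have hu : θ ^ 2 / 4 ≤ 1 - Real.cos θ ^ (2 * n) := by linarith
  have hT1 : 1 / 4 ≤ (T - 1) ^ 2 := by nlinarith [hT.2]
  have hT0 := hT.1
  calc _ = 3 * lo * (1 / 4) * T * (θ ^ 2 / 4) / n := by ring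
    _ ≤ 3 * Q * (T - 1) ^ 2 * T * (1 - Real.cos θ ^ (2 * n)) / n := by
      have hQ0 : 0 ≤ Q := hlo.le.trans hQ.1
      gcongr
      exact hQ.1

/-- A solution of the truncated system on which `T` is bounded below by a positive constant
cannot stay in the region `|θ| ≤ 1/2`, `T ≤ 1/2` for longer than a fixed time. -/
theorem exists_time_bound (hn : 1 ≤ n) (hlo : 0 < lo) (hlh : lo ≤ hi) {τ : ℝ} (hτ : 0 < τ)
    (hτ' : τ ≤ 1 / 2) :
    ∃ B : ℝ, ∀ γ : ℝ → ℝ × ℝ × ℝ, IsIntegralCurve γ (fun _ => boxField n lo hi) →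
      ∀ a b : ℝ, a ≤ b → τ ≤ (γ a).2.1 → |(γ a).1| ≤ 1 / 2 → |(γ b).1| ≤ 1 / 2 →
        (γ b).2.1 ≤ 1 / 2 → b - a ≤ B := by
  have hn0 : (0 : ℝ) < n := by exact_mod_cast hn
  set c : ℝ := 3 * lo / (16 * n) with hc
  have hc0 : 0 < c := by positivity
  have hhi : 0 < hi := hlo.trans_le hlh
  -- `C` is chosen so that `C T'` dominates `9 hi² u² / (2τ)`, where `u` is the clamped `θ`. By
  -- completing a square this exceeds `3 hi |u| - τ/2`, which makes `θ - C T + (τ/2) t`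
  -- nonincreasing.
  set C : ℝ := 9 * hi ^ 2 / (2 * τ) / (c * τ) with hC
  have hC0 : 0 < C := by positivity
  have hCc : C * (c * τ) = 9 * hi ^ 2 / (2 * τ) := by rw [hC]; field_simp
  refine ⟨(1 + C / 2) / (τ / 2), fun γ hγ a b hab hTa hθa hθb hTb => ?_⟩
  have hmono := monotone_snd_fst_of_isIntegralCurve hlo hlh hγ
  have hder : ∀ t, HasDerivAt (fun t => (γ t).1 - C * (γ t).2.1 + τ / 2 * t)
      ((boxField n lo hi (γ t)).1 - C * (boxField n lo hi (γ t)).2.1 + τ / 2 * 1) t := fun t =>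
    ((hγ.hasDerivAt_coords t).1.sub ((hγ.hasDerivAt_coords t).2.1.const_mul C)).add ((hasDerivAt_id t).const_mul (τ / 2))
  have hanti := antitoneOn_of_hasDerivAt_nonpos (convex_Ici a) hder (fun t ht => ?_)
  · have h := hanti (mem_Ici.2 le_rfl) (mem_Ici.2 hab) hab
    simp only at h
    rw [le_div_iff₀ (by positivity)]
    have h1 := abs_le.1 hθa
    have h2 := abs_le.1 hθb
    nlinarith
  · have hTt : τ ≤ (γ t).2.1 := hTa.trans (hmono ht)
    have hTc : τ ≤ clamp 0 (1 / 2) (γ t).2.1 := (le_min hτ' hTt).trans (le_max_right _ _)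
    have e1 := boxField_fst_le hn hlo hlh (γ t)
    have e2 := le_boxField_snd_fst hn hlo hlh (γ t)
    rw [← hc] at e2
    set u := clamp (-(1 / 2)) (1 / 2) (γ t).1
    set T := clamp 0 (1 / 2) (γ t).2.1
    have e3 : c * (τ * u ^ 2) ≤ (boxField n lo hi (γ t)).2.1 := by
      refine le_trans ?_ e2
      gcongr
    have e4 : C * (c * (τ * u ^ 2)) ≤ C * (boxField n lo hi (γ t)).2.1 := by gcongr
    have e5 : C * (c * (τ * u ^ 2)) = 9 * hi ^ 2 / (2 * τ) * |u| ^ 2 := by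
      rw [← hCc, sq_abs]; ring
    have e6 : 3 * hi * |u| - τ / 2 ≤ 9 * hi ^ 2 / (2 * τ) * |u| ^ 2 := by
      rw [div_mul_eq_mul_div, le_div_iff₀ (by positivity)]
      nlinarith [sq_nonneg (3 * hi * |u| - τ)]
    linarith

theorem dist_le_iff_coords {x : ℝ × ℝ × ℝ} {Q r : ℝ} :
    dist x (0, 0, Q) ≤ r ↔ |x.1| ≤ r ∧ |x.2.1| ≤ r ∧ |x.2.2 - Q| ≤ r := by
  simp [Prod.dist_eq, Real.dist_eq]

/-- Orbits of the truncated system with `T > 0` leave every small ball around a de Sitter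
point. -/
theorem exists_exit (hn : 1 ≤ n) (hlo : 0 < lo) (hlh : lo ≤ hi) {Q ε : ℝ} (hε : 0 < ε)
    (hε' : ε ≤ 1 / 2) {δ : ℝ} (hδ : 0 < δ) :
    ∃ γ : ℝ → ℝ × ℝ × ℝ, IsIntegralCurve γ (fun _ => boxField n lo hi) ∧
      dist (γ 0) (0, 0, Q) < δ ∧ (∀ t, 0 ≤ t → 0 ≤ (γ t).2.1) ∧ (γ 0).2.2 = Q ∧
      ∃ t, 0 ≤ t ∧ ε ≤ dist (γ t) (0, 0, Q) := by
  obtain ⟨K, L, hK, hL⟩ := exists_lipschitzWith_boxField hn hlh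
  set τ := min (δ / 2) (1 / 2)
  have hτ : 0 < τ := lt_min (by linarith) (by norm_num)
  obtain ⟨γ, h0, hγ⟩ := exists_isIntegralCurve_of_lipschitzWith hK hL (0, τ, Q)
  have hmono := monotone_snd_fst_of_isIntegralCurve hlo hlh hγ
  refine ⟨γ, hγ, ?_, fun t ht => ?_, by rw [h0], ?_⟩
  · have h1 : dist (γ 0) (0, 0, Q) ≤ τ := by
      rw [h0, dist_le_iff_coords]; simp [abs_of_pos hτ, hτ.le]
    linarith [min_le_left (δ / 2) (1 / 2 : ℝ)]
  · have h := hmono ht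
    simp only [h0] at h
    linarith
  · obtain ⟨B, hB⟩ := exists_time_bound hn hlo hlh hτ (min_le_right _ _)
    by_contra! hlt
    -- An orbit that stayed in the ball up to this time would violate the time bound `B`.
    have hb : 0 ≤ max B 0 + 1 := by positivity
    have h1 := dist_le_iff_coords.1 (hlt _ hb).le
    have := hB γ hγ 0 (max B 0 + 1) hb (by rw [h0]) (by rw [h0]; norm_num) (by linarith)
      (by linarith [le_abs_self (γ (max B 0 + 1)).2.1])
    linarith [le_max_left B 0]

end BoxField

/-- For `Q > 0` the point `(0, 0, Q)` is unstable to the future in every phase space that contains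
all nearby states with `T ≥ 0`. -/
theorem not_lyapunovStable_plField {n : ℕ} (hn : 1 ≤ n) {Q : ℝ} (hQ : 0 < Q)
    {S : Set (ℝ × ℝ × ℝ)} {r : ℝ} (hr : 0 < r)
    (hS : ∀ x : ℝ × ℝ × ℝ, dist x (0, 0, Q) ≤ r → 0 ≤ x.2.1 → x ∈ S) :
    ¬ LyapunovStable (plField n) S (0, 0, Q) := by
  have hε : 0 < min r (min (1 / 2) (Q / 2)) := by positivity
  refine not_lyapunovStable_of_exit (g := boxField n (Q / 2) (3 * Q / 2)) hε fun δ hδ => ?_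
  obtain ⟨γ, hγ, h0, hT, -, hex⟩ := exists_exit hn (lo := Q / 2) (hi := 3 * Q / 2) (Q := Q)
    (by linarith) (by linarith) hε ((min_le_right _ _).trans (min_le_left _ _)) hδ
  refine ⟨γ, hγ, h0, fun t ht hd => ⟨hS _ (hd.trans (min_le_left _ _)) (hT t ht), ?_⟩, hex⟩
  have h2 := dist_le_iff_coords.1 (hd.trans (min_le_right _ _))
  have h3 := abs_le.1 (h2.2.2.trans (min_le_right _ _))
  exact boxField_eq (h2.1.trans (min_le_left _ _))
    ⟨hT t ht, (le_abs_self _).trans (h2.2.1.trans (min_le_left _ _))⟩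
    ⟨by linarith, by linarith⟩

/-! ## Attracted and repelled orbits -/

theorem AttractsOrbit.mono {E : Type*} [NormedAddCommGroup E] [NormedSpace ℝ E] {f : E → E}
    {S S' : Set E} {p : E} (h : AttractsOrbit f S p) (hS : S ⊆ S') : AttractsOrbit f S' p := by
  obtain ⟨γ, hγ, hγS, h0, hlim⟩ := h
  exact ⟨γ, hγ, fun t ht => hS (hγS t ht), h0, hlim⟩

/-- Outside the interval the sine is frozen at `± sin 1`, with the sign of `y`; hence the truncated
scalar equation still pushes towards `0`. -/
theorem mul_sin_two_mul_clamp_nonneg (y : ℝ) :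
    0 ≤ y * Real.sin (2 * clamp (-(1 / 2)) (1 / 2) y) := by
  have hs : 0 ≤ Real.sin 1 :=
    Real.sin_nonneg_of_nonneg_of_le_pi (by norm_num) (by linarith [Real.pi_gt_three])
  rcases le_total |y| (1 / 2) with h | h
  · rw [clamp_of_mem (abs_le.1 h)]
    exact (sq_nonneg y).trans (sq_le_mul_sin_two_mul h)
  · rcases le_abs.1 h with h | h
    · have : clamp (-(1 / 2)) (1 / 2) y = 1 / 2 := by
        rw [clamp, min_eq_left h, max_eq_right (by norm_num)]
      rw [this, mul_one_div_cancel two_ne_zero]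
      exact mul_nonneg (by linarith) hs
    · have : clamp (-(1 / 2)) (1 / 2) y = -(1 / 2) := by
        rw [clamp, max_eq_left]
        exact (min_le_right _ _).trans (by linarith)
      rw [this, mul_neg, mul_one_div_cancel two_ne_zero, Real.sin_neg]
      nlinarith

/-- The orbits in the invariant plane `T = 0` that end at `(0, 0, Q)` lie on the curve
`(1 - q²) / cos^{2n} θ = 1 - Q²`. -/
noncomputable def separatrix (n : ℕ) (Q θ : ℝ) : ℝ := √(1 - (1 - Q ^ 2) * Real.cos θ ^ (2 * n))

section Separatrix

variable {n : ℕ} {Q : ℝ}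

/-- The radicand is the convex combination of `1` and `Q²` with weight `cos^{2n} θ` on `Q²`. -/
theorem min_le_separatrix_radicand (n : ℕ) (Q θ : ℝ) :
    min 1 (Q ^ 2) ≤ 1 - (1 - Q ^ 2) * Real.cos θ ^ (2 * n) := by
  have h0 : 0 ≤ Real.cos θ ^ (2 * n) := (even_two_mul n).pow_nonneg _
  have h1 := cos_pow_two_mul_le_one n θ
  nlinarith [min_le_left 1 (Q ^ 2), min_le_right 1 (Q ^ 2)]

theorem separatrix_radicand_pos (hQ : 0 < Q) (n : ℕ) (θ : ℝ) :
    0 < 1 - (1 - Q ^ 2) * Real.cos θ ^ (2 * n) :=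
  (lt_min one_pos (pow_pos hQ 2)).trans_le (min_le_separatrix_radicand n Q θ)

theorem sqrt_min_le_separatrix (n : ℕ) (Q θ : ℝ) : √(min 1 (Q ^ 2)) ≤ separatrix n Q θ :=
  Real.sqrt_le_sqrt (min_le_separatrix_radicand n Q θ)

theorem separatrix_le_one (hQ : 0 < Q) (hQ1 : Q ≤ 1) (n : ℕ) (θ : ℝ) : separatrix n Q θ ≤ 1 := by
  rw [separatrix, Real.sqrt_le_one]
  have h0 : 0 ≤ Real.cos θ ^ (2 * n) := (even_two_mul n).pow_nonneg _
  nlinarith [mul_nonneg (by nlinarith : 0 ≤ 1 - Q ^ 2) h0]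

theorem contDiff_separatrix (hQ : 0 < Q) : ContDiff ℝ 1 (separatrix n Q) :=
  ContDiff.sqrt (by fun_prop) fun θ => (separatrix_radicand_pos hQ n θ).ne'

theorem hasDerivAt_separatrix (hQ : 0 < Q) (θ : ℝ) :
    HasDerivAt (separatrix n Q)
      ((1 - Q ^ 2) * (n * Real.cos θ ^ (2 * n - 1) * Real.sin θ) / separatrix n Q θ) θ := by
  have h1 := (((Real.hasDerivAt_cos θ).pow (2 * n)).const_mul (1 - Q ^ 2)).const_sub 1
  have h2 := h1.sqrt (separatrix_radicand_pos hQ n θ).ne'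
  refine h2.congr_deriv ?_
  have h3 : separatrix n Q θ ≠ 0 := (Real.sqrt_pos.2 (separatrix_radicand_pos hQ n θ)).ne'
  change _ / (2 * separatrix n Q θ) = _
  rw [div_eq_div_iff (by positivity) h3]
  push_cast
  ring

/-- The curve `T = 0`, `q = separatrix n Q θ` is invariant. -/
theorem plField_separatrix (hn : 1 ≤ n) (hQ : 0 < Q) (θ : ℝ) :
    (1 - Q ^ 2) * (n * Real.cos θ ^ (2 * n - 1) * Real.sin θ) / separatrix n Q θ *
      (plField n (θ, 0, separatrix n Q θ)).1 = (plField n (θ, 0, separatrix n Q θ)).2.2 := by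
  have hn0 : (n : ℝ) ≠ 0 := by positivity
  have hq : 0 < separatrix n Q θ := Real.sqrt_pos.2 (separatrix_radicand_pos hQ n θ)
  have hq2 : separatrix n Q θ ^ 2 = 1 - (1 - Q ^ 2) * Real.cos θ ^ (2 * n) :=
    Real.sq_sqrt (separatrix_radicand_pos hQ n θ).le
  have hc : Real.cos θ ^ (2 * n) = Real.cos θ ^ (2 * n - 1) * Real.cos θ := by
    rw [← pow_succ]; congr 1; omega
  simp only [plField, hq2, one_sub_cos_pow_eq, Real.sin_two_mul]
  rw [hc]
  field_simp
  ring

/-- For `Q > 0` the point `(0, 0, Q)` attracts an orbit in the plane `T = 0`. -/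
theorem attractsOrbit_plField (hn : 1 ≤ n) (hQ : 0 < Q) :
    AttractsOrbit (plField n) {x | x.2.1 = 0 ∧ (Q ≤ 1 → |x.2.2| ≤ 1)} (0, 0, Q) := by
  have hn0 : (0 : ℝ) < n := by exact_mod_cast hn
  -- On the invariant curve the system reduces to the scalar equation `u' = h u`, solved here with a
  -- clamped argument and `u 0 = 1/2`.
  set h : ℝ → ℝ := fun θ => (plField n (θ, 0, separatrix n Q θ)).1 with hh
  have hC : ContDiff ℝ 1 h := by
    have h1 := contDiff_plField hn
    have h2 := contDiff_separatrix (n := n) hQ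
    fun_prop
  obtain ⟨K, L, hK, hL⟩ := hC.exists_lipschitzWith_comp
    (lipschitzWith_clamp (-(1 / 2)) (1 / 2)) (isCompact_Icc (a := (-(1 / 2) : ℝ)) (b := 1 / 2))
    (convex_Icc _ _) (clamp_mem (by norm_num))
  obtain ⟨u, hu0, hu⟩ := exists_isIntegralCurve_of_lipschitzWith hK hL (1 / 2)
  set k : ℝ := 3 * √(min 1 (Q ^ 2)) / (2 * n) with hk
  have hk0 : 0 < k := by
    have : 0 < √(min 1 (Q ^ 2)) := Real.sqrt_pos.2 (lt_min one_pos (pow_pos hQ 2))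
    positivity
  have hle : ∀ y θ : ℝ, 0 ≤ y * Real.sin (2 * θ) → y * h θ ≤ -(k * (y * Real.sin (2 * θ))) := by
    intro y θ hy
    have e1 : y * h θ =
        -(3 * separatrix n Q θ * powerF n θ ^ 2 / (2 * n) * (y * Real.sin (2 * θ))) := by
      simp only [hh, plField]; ring
    have e2 : k ≤ 3 * separatrix n Q θ * powerF n θ ^ 2 / (2 * n) := by
      have h1 := sqrt_min_le_separatrix n Q θ
      have h2 : 1 ≤ powerF n θ ^ 2 := one_le_powerF hn θ |> one_le_pow₀
      have h3 : √(min 1 (Q ^ 2)) ≤ separatrix n Q θ * powerF n θ ^ 2 := by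
        nlinarith [Real.sqrt_nonneg (min 1 (Q ^ 2))]
      rw [hk, mul_assoc]
      gcongr
    rw [e1]
    gcongr
  have hz : ∀ t, HasDerivAt (fun t => u t ^ 2)
      (2 * (u t * h (clamp (-(1 / 2)) (1 / 2) (u t)))) t := fun t =>
    ((hu t).pow 2).congr_deriv (by push_cast; ring)
  have hz_anti : Antitone fun t => u t ^ 2 := antitone_of_hasDerivAt_nonpos hz fun t => by
    have h1 := mul_sin_two_mul_clamp_nonneg (u t)
    have h2 := hle _ _ h1
    have h3 := mul_nonneg hk0.le h1
    simp only [Pi.zero_apply]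
    linarith
  -- Since `u²` decreases from `1/4`, the clamp is inactive for `t ≥ 0`.
  have habs : ∀ t, 0 ≤ t → |u t| ≤ 1 / 2 := fun t ht => by
    have h1 : u t ^ 2 ≤ u 0 ^ 2 := hz_anti ht
    rw [hu0] at h1
    exact abs_le_of_sq_le_sq h1 (by norm_num)
  have hcl : ∀ t, 0 ≤ t → clamp (-(1 / 2)) (1 / 2) (u t) = u t := fun t ht =>
    clamp_of_mem (abs_le.1 (habs t ht))
  have hexp : AntitoneOn (fun t => u t ^ 2 * Real.exp (2 * k * t)) (Ici 0) := by
    refine antitoneOn_of_hasDerivAt_nonpos (convex_Ici 0) (fun t => (hz t).mul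
      (((hasDerivAt_id t).const_mul (2 * k)).exp)) fun t ht => ?_
    have h1 := sq_le_mul_sin_two_mul (habs t ht)
    have h2 := hle (u t) (u t) ((sq_nonneg _).trans h1)
    have h3 : k * u t ^ 2 ≤ k * (u t * Real.sin (2 * u t)) := by gcongr
    rw [hcl t ht]
    have h4 := mul_nonneg (Real.exp_pos (2 * k * t)).le
      (by linarith : 0 ≤ -(u t * h (u t) + k * u t ^ 2))
    simp only [id_eq]
    linarith
  have hlim : Tendsto u atTop (𝓝 0) := by
    have h1 : Tendsto (fun t => 1 / 4 * Real.exp (-(2 * k * t))) atTop (𝓝 0) := by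
      have := (Real.tendsto_exp_neg_atTop_nhds_zero.comp
        (tendsto_id.const_mul_atTop (by positivity : 0 < 2 * k))).const_mul (1 / 4 : ℝ)
      simpa [Function.comp_def] using this
    have h2 : Tendsto (fun t => u t ^ 2) atTop (𝓝 0) := by
      refine squeeze_zero' (Eventually.of_forall fun t => sq_nonneg _) ?_ h1
      filter_upwards [eventually_ge_atTop 0] with t ht
      have := hexp (mem_Ici.2 le_rfl) (mem_Ici.2 ht) ht
      simp only [hu0, mul_zero, Real.exp_zero] at this
      rw [Real.exp_neg, ← div_eq_mul_inv, le_div_iff₀ (Real.exp_pos _)]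
      linarith
    have h3 := (Real.continuous_sqrt.tendsto 0).comp h2
    simp only [Real.sqrt_zero, Function.comp_def, Real.sqrt_sq_eq_abs] at h3
    exact (tendsto_zero_iff_abs_tendsto_zero u).2 h3
  refine ⟨fun t => (u t, 0, separatrix n Q (u t)), fun t ht => ?_, fun t _ => ⟨rfl, fun hQ1 => ?_⟩,
    ?_, ?_⟩
  · have h1 : HasDerivAt u (h (u t)) t := by
      have := hu t
      simp only [hcl t ht] at this
      exact this
    have h2 := (hasDerivAt_separatrix (n := n) hQ (u t)).comp t h1
    rw [hh] at h2
    simp only [plField_separatrix hn hQ] at h2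
    have h3 := h1.prodMk ((hasDerivAt_const t (0 : ℝ)).prodMk h2)
    refine (h3.congr_deriv ?_).hasDerivWithinAt
    refine Prod.ext rfl (Prod.ext ?_ rfl)
    simp [plField]
  · change |separatrix n Q (u t)| ≤ 1
    have h1 : 0 ≤ separatrix n Q (u t) := Real.sqrt_nonneg _
    rw [abs_of_nonneg h1]
    exact separatrix_le_one hQ hQ1 n (u t)
  · simp [hu0]
  · have h1 : separatrix n Q 0 = Q := by simp [separatrix, Real.sqrt_sq hQ.le]
    have h2 := ((contDiff_separatrix (n := n) hQ).continuous.tendsto 0).comp hlim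
    rw [h1] at h2
    exact hlim.prodMk_nhds (tendsto_const_nhds.prodMk_nhds h2)

end Separatrix

/-- A bounded function with `z' ≤ -k z + k m` on a negative half-line is at most `m` there. -/
theorem le_of_hasDerivAt_le_of_bounded {z z' : ℝ → ℝ} (hz : ∀ t, HasDerivAt z (z' t) t)
    {k m M a : ℝ} (hk : 0 < k) (hM : ∀ t ≤ a, z t ≤ M)
    (h : ∀ t ≤ a, z' t ≤ -(k * z t) + k * m) {t : ℝ} (ht : t ≤ a) : z t ≤ m := by
  -- The weighted excess over `m` decreases forward in time, while boundedness of `z` caps it by a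
  -- quantity that vanishes at `-∞`; hence it is never positive.
  have hanti : AntitoneOn (fun s => (z s - m) * Real.exp (k * s)) (Iic a) := by
    refine antitoneOn_of_hasDerivAt_nonpos (convex_Iic a) (fun s => ((hz s).sub_const m).mul
      (((hasDerivAt_id s).const_mul k).exp)) fun s hs => ?_
    have h1 := h s hs
    have h2 := mul_nonneg (Real.exp_pos (k * s)).le
      (by linarith : 0 ≤ -(z' s + k * (z s - m)))
    simp only [id_eq]
    linarith
  have hlim : Tendsto (fun s => (M - m) * Real.exp (k * s)) atBot (𝓝 0) := by
    have := (Real.tendsto_exp_atBot.comp (tendsto_id.const_mul_atBot hk)).const_mul (M - m)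
    simpa [Function.comp_def] using this
  have h0 : (z t - m) * Real.exp (k * t) ≤ 0 := by
    refine ge_of_tendsto hlim ?_
    filter_upwards [eventually_le_atBot t] with s hs
    refine (hanti (hs.trans ht) ht hs).trans ?_
    exact mul_le_mul_of_nonneg_right (sub_le_sub_right (hM s (hs.trans ht)) m) (Real.exp_pos _).le
  have := nonpos_of_mul_nonpos_left h0 (Real.exp_pos _)
  linarith

/-- At `Q = 1` the sine term damps `θ²` at rate at least `3 / (2n)`, and `T F` acts as a forcing of
size at most `n T`. -/
theorem plField_mul_fst_le {n : ℕ} (hn : 1 ≤ n) {θ T : ℝ} (hθ : |θ| ≤ 1 / 2)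
    (hT : T ∈ Icc 0 (1 / 2)) :
    2 * (θ * (plField n (θ, T, 1)).1) ≤ -(3 / (2 * n) * θ ^ 2) + n * T := by
  have hn0 : (0 : ℝ) < n := by exact_mod_cast hn
  have hs := sq_le_mul_sin_two_mul hθ
  have hF : 1 ≤ powerF n θ ^ 2 := one_le_pow₀ (one_le_powerF hn θ)
  have hFn := powerF_le n θ
  have hF0 := powerF_nonneg n θ
  have e1 : 2 * (θ * (plField n (θ, T, 1)).1) =
      -(3 * (1 - T) * powerF n θ ^ 2 * (θ * Real.sin (2 * θ)) / n) +
        2 * (-θ) * (T * powerF n θ) := by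
    simp only [plField]; field_simp; ring
  have e2 : 3 / (2 * n) * θ ^ 2 ≤
      3 * (1 - T) * powerF n θ ^ 2 * (θ * Real.sin (2 * θ)) / n := by
    calc 3 / (2 * n) * θ ^ 2 = 3 * (1 / 2) * 1 * θ ^ 2 / n := by field_simp
      _ ≤ _ := by
        have : 1 / 2 ≤ 1 - T := by linarith [hT.2]
        have : 0 ≤ 1 - T := by linarith
        gcongr
  have e3 : 2 * (-θ) * (T * powerF n θ) ≤ 1 * (T * n) := by
    have hT0 := hT.1
    have : 2 * (-θ) ≤ 1 := by linarith [(abs_le.1 hθ).1]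
    calc _ ≤ 1 * (T * powerF n θ) := by gcongr
      _ ≤ _ := by gcongr
  rw [e1]
  linarith

/-- The de Sitter point `(0, 0, 1)` repels an orbit, on its center manifold in the plane
`Q = 1`. -/
theorem repelsOrbit_plField {n : ℕ} (hn : 1 ≤ n) :
    RepelsOrbit (plField n) plPhaseSpace (0, 0, 1) := by
  have hn0 : (0 : ℝ) < n := by exact_mod_cast hn
  -- The degenerate range `lo = hi = 1` makes `Q' = 0` for the truncated field, so the plane `Q = 1`
  -- is preserved.
  obtain ⟨K, L, hK, hL⟩ := exists_lipschitzWith_boxField hn (le_refl (1 : ℝ))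
  have hp : boxField n 1 1 (0, 0, 1) = 0 := by
    rw [boxField_eq (by simp) (by simp) (by simp), plField_apply_de_sitter]
  have hclosed : IsClosed {x : ℝ × ℝ × ℝ | 0 ≤ x.2.1 ∧ x.2.2 = 1} :=
    (isClosed_Ici.preimage (f := fun x : ℝ × ℝ × ℝ => x.2.1) (by fun_prop)).inter
      (isClosed_singleton.preimage (f := fun x : ℝ × ℝ × ℝ => x.2.2) (by fun_prop))
  obtain ⟨σ, hσ, hσ0, hσC⟩ := exists_isIntegralCurve_mem_closedBall_of_exit hK hL hp
    (ε := 1 / 2) (by norm_num) hclosed fun δ hδ => by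
      obtain ⟨γ, hγ, h0, hT, hQ0, hex⟩ := exists_exit hn one_pos le_rfl (Q := 1)
        (ε := 1 / 2) (by norm_num) le_rfl hδ
      refine ⟨γ, hγ, h0, fun t ht => ⟨hT t ht, ?_⟩, hex⟩
      have hQ : ∀ t, HasDerivAt (fun t => (γ t).2.2) 0 t := fun t => by
        refine (hγ.hasDerivAt_coords t).2.2.congr_deriv ?_
        simp [boxField, boxProj, plField, clamp]
      rw [← hQ0]
      exact is_const_of_deriv_eq_zero (fun t => (hQ t).differentiableAt)
        (fun t => (hQ t).deriv) t 0
  have hθ : ∀ t ≤ 0, |(σ t).1| ≤ 1 / 2 := fun t ht => (dist_le_iff_coords.1 (hσC t ht).2).1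
  have hT : ∀ t ≤ 0, (σ t).2.1 ∈ Icc 0 (1 / 2) := fun t ht =>
    ⟨(hσC t ht).1.1, (le_abs_self _).trans (dist_le_iff_coords.1 (hσC t ht).2).2.1⟩
  have hQ : ∀ t ≤ 0, (σ t).2.2 = 1 := fun t ht => (hσC t ht).1.2
  have hbox : ∀ t ≤ 0, boxField n 1 1 (σ t) = plField n (σ t) := fun t ht =>
    boxField_eq (hθ t ht) (hT t ht) (by simp [hQ t ht])
  -- If `T ≥ τ` at a time `t ≤ 0`, the orbit stays in the box from `t` to `0`, so the time bound
  -- gives `-t ≤ B`.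
  have hTlim : ∀ τ, 0 < τ → ∀ᶠ t in atBot, (σ t).2.1 < τ := by
    intro τ hτ
    obtain ⟨B, hB⟩ := exists_time_bound hn one_pos (le_refl (1 : ℝ)) (τ := min τ (1 / 2))
      (lt_min hτ (by norm_num)) (min_le_right _ _)
    filter_upwards [eventually_lt_atBot (-B), eventually_le_atBot 0] with t ht ht0
    by_contra! hlt
    have := hB σ hσ t 0 ht0 ((min_le_left _ _).trans hlt) (hθ t ht0) (hθ 0 le_rfl)
      (hT 0 le_rfl).2
    linarith
  have hTt : Tendsto (fun t => (σ t).2.1) atBot (𝓝 0) := by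
    rw [Metric.tendsto_nhds]
    intro τ hτ
    filter_upwards [hTlim τ hτ, eventually_le_atBot 0] with t ht ht0
    rwa [Real.dist_eq, sub_zero, abs_of_nonneg (hT t ht0).1]
  set k : ℝ := 3 / (2 * n) with hk
  have hk0 : 0 < k := by positivity
  have hder : ∀ t, HasDerivAt (fun t => (σ t).1 ^ 2)
      (2 * ((σ t).1 * (boxField n 1 1 (σ t)).1)) t := fun t =>
    ((hσ.hasDerivAt_coords t).1.pow 2).congr_deriv (by push_cast; ring)
  have hz : Tendsto (fun t => (σ t).1 ^ 2) atBot (𝓝 0) := by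
    rw [Metric.tendsto_nhds]
    intro m hm
    -- This threshold makes the forcing `n T` smaller than `k m / 2`, so the comparison lemma yields
    -- `θ² ≤ m/2`.
    obtain ⟨a, ha⟩ := eventually_atBot.1
      ((hTlim (k * (m / 2) / n) (by positivity)).and (eventually_le_atBot 0))
    filter_upwards [eventually_le_atBot a] with t ht
    rw [Real.dist_eq, sub_zero, abs_of_nonneg (sq_nonneg _)]
    refine (le_of_hasDerivAt_le_of_bounded hder hk0 (m := m / 2) (M := (1 / 2) ^ 2) (a := a)
      (fun s hs => ?_) (fun s hs => ?_) ht).trans_lt (by linarith)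
    · rw [← sq_abs]
      have := hθ s (ha s hs).2
      gcongr
    · obtain ⟨hs1, hs2⟩ := ha s hs
      rw [hbox s hs2]
      have h1 := plField_mul_fst_le hn (hθ s hs2) (hT s hs2)
      have h2 : ((σ s).1, (σ s).2.1, (1 : ℝ)) = σ s := by rw [← hQ s hs2]
      rw [h2] at h1
      rw [lt_div_iff₀ hn0] at hs1
      linarith
  have hθt : Tendsto (fun t => (σ t).1) atBot (𝓝 0) := by
    have h3 := (Real.continuous_sqrt.tendsto 0).comp hz
    simp only [Real.sqrt_zero, Function.comp_def, Real.sqrt_sq_eq_abs] at h3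
    exact (tendsto_zero_iff_abs_tendsto_zero _).2 h3
  have hQt : Tendsto (fun t => (σ t).2.2) atBot (𝓝 1) :=
    tendsto_const_nhds.congr' (by
      filter_upwards [eventually_le_atBot 0] with t ht
      exact (hQ t ht).symm)
  refine ⟨fun t => σ (-t), fun t ht => ?_, fun t ht => ?_, ?_, ?_⟩
  · have ht' : -t ≤ 0 := by simpa using ht
    have h1 := (hσ (-t)).scomp t (hasDerivAt_neg t)
    change HasDerivAt _ ((-1 : ℝ) • boxField n 1 1 (σ (-t))) t at h1
    rw [hbox _ ht'] at h1
    simpa [Function.comp_def] using h1.hasDerivWithinAt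
  · have ht' : -t ≤ 0 := by simpa using ht
    exact ⟨⟨(hT _ ht').1, (hT _ ht').2.trans (by norm_num)⟩, by rw [hQ _ ht']; simp⟩
  · intro h
    simp only [neg_zero] at h
    rw [h, dist_self] at hσ0
    norm_num at hσ0
  · exact (hθt.prodMk_nhds (hTt.prodMk_nhds hQt)).comp tendsto_neg_atTop_atBot

/-! ## The time-reversing symmetry -/

/-- The symmetry `(θ, T, Q) ↦ (-θ, T, -Q)`, which reverses time. -/
noncomputable def reflection : ℝ × ℝ × ℝ →L[ℝ] ℝ × ℝ × ℝ :=
  (-ContinuousLinearMap.fst ℝ ℝ (ℝ × ℝ)).prod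
    (((ContinuousLinearMap.fst ℝ ℝ ℝ).comp (ContinuousLinearMap.snd ℝ ℝ (ℝ × ℝ))).prod
      (-((ContinuousLinearMap.snd ℝ ℝ ℝ).comp (ContinuousLinearMap.snd ℝ ℝ (ℝ × ℝ)))))

theorem reflection_apply (x : ℝ × ℝ × ℝ) : reflection x = (-x.1, x.2.1, -x.2.2) := rfl

theorem isometry_reflection : Isometry reflection :=
  Isometry.of_dist_eq fun x y => by simp [reflection_apply, Prod.dist_eq, dist_neg_neg]

theorem powerF_neg (n : ℕ) (θ : ℝ) : powerF n (-θ) = powerF n θ := by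
  simp [powerF_eq]

theorem plField_reflection (n : ℕ) (x : ℝ × ℝ × ℝ) :
    plField n (reflection x) = -reflection (plField n x) := by
  simp only [reflection_apply, plField, powerF_neg, mul_neg, Real.sin_neg, Real.cos_neg]
  refine Prod.ext ?_ (Prod.ext ?_ ?_) <;> simp only [Prod.neg_mk] <;> ring

theorem reflection_mem_plPhaseSpace {x : ℝ × ℝ × ℝ} (hx : x ∈ plPhaseSpace) :
    reflection x ∈ plPhaseSpace :=
  ⟨hx.1, by simpa [reflection_apply, and_comm, neg_le] using hx.2⟩

theorem reflection_mem_plStrip {x : ℝ × ℝ × ℝ} (hx : x ∈ plStrip) : reflection x ∈ plStrip := hx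

/-- A de Sitter point with `Q ≠ 0` is a saddle in every phase space `S` that is symmetric, contains
all nearby states with `T ≥ 0`, and contains the attracted orbit in the plane `T = 0`. -/
theorem isSaddle_plField {n : ℕ} (hn : 1 ≤ n) {S : Set (ℝ × ℝ × ℝ)} {Q : ℝ} (hQ : Q ≠ 0)
    (hR : ∀ x ∈ S, reflection x ∈ S) {r : ℝ} (hr : 0 < r)
    (hS : ∀ x : ℝ × ℝ × ℝ, dist x (0, 0, |Q|) ≤ r → 0 ≤ x.2.1 → x ∈ S)
    (hS' : {x : ℝ × ℝ × ℝ | x.2.1 = 0 ∧ (|Q| ≤ 1 → |x.2.2| ≤ 1)} ⊆ S) :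
    IsSaddle (plField n) S (0, 0, Q) ∧ (0 < Q → AttractsOrbit (plField n) S (0, 0, Q)) ∧
      (Q < 0 → RepelsOrbit (plField n) S (0, 0, Q)) := by
  have hQ0 : 0 < |Q| := abs_pos.2 hQ
  have hst := not_lyapunovStable_plField hn hQ0 hr hS
  have hat := (attractsOrbit_plField hn hQ0).mono hS'
  have hmem : (0, 0, |Q|) ∈ S := hS _ (by simpa using hr.le) le_rfl
  rcases hQ.lt_or_gt with hneg | hpos
  · have hp : reflection (0, 0, |Q|) = (0, 0, Q) := by
      simp [reflection_apply, abs_of_neg hneg]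
    -- In this form the symmetry conjugates the field to its time reversal, so it exchanges
    -- attraction with repulsion and future with past stability.
    have hfg : ∀ x, (-plField n) (reflection x) = reflection (plField n x) := fun x => by
      simp [plField_reflection]
    have hrep : RepelsOrbit (plField n) S (0, 0, Q) := by
      rw [← hp]
      exact hat.map reflection isometry_reflection.injective hfg hR
    refine ⟨⟨hp ▸ hR _ hmem, plField_apply_de_sitter n Q, hrep.not_lyapunovStable, fun h => ?_,
      Or.inr hrep⟩, fun h => absurd h hneg.not_gt, fun _ => hrep⟩
    rw [← hp] at h
    exact hst (h.of_map reflection isometry_reflection hfg hR)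
  · rw [abs_of_pos hpos] at hst hat hmem
    exact ⟨⟨hmem, plField_apply_de_sitter n Q, hst, hat.not_lyapunovStable_neg, Or.inl hat⟩,
      fun _ => hat, fun h => absurd h hpos.not_gt⟩

theorem proposition9 (n : ℕ) (hn : 1 ≤ n) :
    (IsSaddle (plField n) plPhaseSpace (0, 0, 1) ∧
      AttractsOrbit (plField n) plPhaseSpace (0, 0, 1) ∧
      RepelsOrbit (plField n) plPhaseSpace (0, 0, 1)) ∧
    (∀ Qs : ℝ, Qs ≠ 0 → Qs ≠ 1 → Qs ≠ -1 →
      (IsSaddle (plField n) plStrip (0, 0, Qs) ∧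
        (0 < Qs → AttractsOrbit (plField n) plStrip (0, 0, Qs)) ∧
        (Qs < 0 → RepelsOrbit (plField n) plStrip (0, 0, Qs))) ∧
      (|Qs| < 1 →
        IsSaddle (plField n) plPhaseSpace (0, 0, Qs) ∧
        (0 < Qs → AttractsOrbit (plField n) plPhaseSpace (0, 0, Qs)) ∧
        (Qs < 0 → RepelsOrbit (plField n) plPhaseSpace (0, 0, Qs)))) := by
  have hplane : ∀ {q : ℝ}, q ≤ 1 →
      {x : ℝ × ℝ × ℝ | x.2.1 = 0 ∧ (q ≤ 1 → |x.2.2| ≤ 1)} ⊆ plPhaseSpace := by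
    rintro q hq x ⟨hT, hx⟩
    exact ⟨by simp [hT], abs_le.1 (hx hq)⟩
  refine ⟨?_, fun Qs hQ0 _ _ => ⟨?_, fun hQ => ?_⟩⟩
  -- Phase-space neighbourhoods of `Q = 1` are one-sided, so the ball hypothesis of
  -- `isSaddle_plField` fails; both instabilities come from the two asymptotic orbits instead.
  · have hat := (attractsOrbit_plField hn one_pos).mono (hplane le_rfl)
    have hrep := repelsOrbit_plField hn
    exact ⟨⟨by simp [plPhaseSpace], plField_apply_de_sitter n 1, hrep.not_lyapunovStable,
      hat.not_lyapunovStable_neg, Or.inl hat⟩, hat, hrep⟩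
  · refine isSaddle_plField hn hQ0 (fun x => reflection_mem_plStrip) one_pos
      (fun x hx hT => ?_) fun x hx => ?_
    · exact ⟨hT, (le_abs_self _).trans (dist_le_iff_coords.1 hx).2.1⟩
    · simp [plStrip, hx.1]
  -- The radius `1 - |Qs|` keeps nearby states within `-1 ≤ Q ≤ 1`.
  · refine isSaddle_plField hn hQ0 (fun x => reflection_mem_plPhaseSpace) (sub_pos.2 hQ)
      (fun x hx hT => ?_) (hplane hQ.le)
    have h := dist_le_iff_coords.1 hx
    have h1 := abs_le.1 h.2.2
    have h2 := abs_nonneg Qs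
    exact ⟨⟨hT, by linarith [le_abs_self x.2.1]⟩, by linarith, by linarith⟩
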